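/- Let $n,r,d\ge 0$ be integers with $r\le n$. Let $\binom{[n]}{r}\subset\{0,1\}^n$ be the set of binary sequences $x^n=(x_1,\dots,x_n)$ with exactly $r$ ones, and let $X^n$ be uniformly distributed on it. A source code is an injective map $\mathsf{c}$ from $\binom{[n]}{r}$ to the set of nonempty finite binary strings; $\ell(b)$ denotes the length of a string $b$. It is a non-adaptive $(r,d,n)$-locally decodable code if there are a probing rule, assigning to every query index $j\in[n]$ and every codeword length $\ell$ a set $S_{j,\ell}\subseteq\{1,\dots,\ell\}$ with $|S_{j,\ell}|\le d$, and a decoding rule which, for every $x^n\in\binom{[n]}{r}$ and every $j\in[n]$, outputs $x_j$ given only $j$, $\ell=\ell(\mathsf{c}(x^n))$ and the bits of $\mathsf{c}(x^n)$ at the positions in $S_{j,\ell}$. Then there exists a non-adaptive $(r,d,n)$-locally decodable code $\mathsf{c}$ with $$\mathbb{E}\big[\ell(\mathsf{c}(X^n))\big]\;\le\; 30\,(rd+1)\left((r+1)^{r+1}\binom{n}{r}\right)^{1/(rd+1)} .$$ -/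

import Mathlib

open scoped BigOperators

/-- The binary sequences of length `n` having Hamming weight exactly `r`
(coordinates are indexed by `Fin n`). -/
abbrev SparseSeq (r n : ℕ) : Type :=
  {x : Fin n → Bool // (Finset.univ.filter fun j => x j = true).card = r}

/-- A variable-length source code for `r`-sparse sequences of length `n`: an injective map into
the nonempty finite binary strings `{0, 1, 00, 01, 10, …}`. -/
structure SparseSourceCode (r n : ℕ) where
  /-- the codeword of a source sequence -/
  codeword : SparseSeq r n → List Bool
  /-- every codeword has at least one bit -/
  codeword_ne_nil : ∀ x, codeword x ≠ []
  /-- distinct sequences have distinct codewords -/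
  injective : Function.Injective codeword

namespace SparseSourceCode

/-- `c` is a non-adaptive `(r,d,n)`-locally decodable code: there is a probing rule that assigns to
each query index `j` and each codeword length `ℓ` a set of at most `d` positions of a string of
length `ℓ`, and a decoding rule which, given only `j`, `ℓ` and the bits of the codeword at these
positions, always outputs the source bit `x j`. -/
def IsNonadaptiveLocallyDecodable {r n : ℕ} (c : SparseSourceCode r n) (d : ℕ) : Prop :=
  ∃ (probes : Fin n → (ℓ : ℕ) → Finset (Fin ℓ))
    (decode : (j : Fin n) → (ℓ : ℕ) → (↥(probes j ℓ) → Bool) → Bool),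
    (∀ (j : Fin n) (ℓ : ℕ), (probes j ℓ).card ≤ d) ∧
    ∀ (x : SparseSeq r n) (j : Fin n),
      decode j (c.codeword x).length (fun i => (c.codeword x).get i.1) = x.1 j

/-- The expected codeword length when the source sequence is uniformly distributed over all
`r`-sparse sequences of length `n`. -/
noncomputable def expectedLength {r n : ℕ} (c : SparseSourceCode r n) : ℝ :=
  Finset.expect Finset.univ fun x : SparseSeq r n => ((c.codeword x).length : ℝ)

end SparseSourceCode

/-! Probabilistic method plus greedy choice of lengths. Give each index `d` random positions in
`[W]`; encode `x` as the indicator of the positions touched by its support, and decode an index by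
the conjunction of its probes. This works at any length at least `L` if the support lands in the
first `L` positions and every other index has an untouched position. For suitable `W`, a support
does so with probability at least `Q = (L/W)^(rd)/(r+1)`, so by averaging one assignment serves a
fraction `Q` of any given set of sequences (`exists_served_fraction`).

The length itself carries information: a new assignment at each length `L, L+1, …` serves a fraction
`Q` of the sequences still left, so the mean length is at most `L - 1 + 1/Q`
(`exists_length_assignment`). Balancing `L` against `1/Q` gives the bound. -/

/-- A set of sparse sequences is served by length `ℓ` if one choice of at most `d` probes per index
and one decoding rule recover all of its members from suitable strings of length `ℓ`. -/
def ServedByLength {r n : ℕ} (d ℓ : ℕ) (A : Finset (SparseSeq r n)) : Prop :=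
  ∃ (probes : Fin n → Finset (Fin ℓ)) (decode : (j : Fin n) → (↥(probes j) → Bool) → Bool),
    (∀ j, (probes j).card ≤ d) ∧
    ∀ x ∈ A, ∃ b : Fin ℓ → Bool, ∀ j, decode j (fun i => b i.1) = x.1 j

/-! ### Greedy assignment of lengths -/

/-- Serving a fixed fraction `Q` of the remaining sequences at each successive length gives a length
assignment whose average is at most `ℓ - 1 + 1 / Q`. -/
theorem exists_length_assignment {r n d L : ℕ} {Q : ℝ} (hQ : 0 < Q)
    (h : ∀ ℓ, L ≤ ℓ → ∀ U : Finset (SparseSeq r n), ∃ A ⊆ U, Q * (U.card : ℝ) ≤ A.card ∧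
      ServedByLength d ℓ A) (U : Finset (SparseSeq r n)) :
    ∀ ℓ, L ≤ ℓ → ∃ len : SparseSeq r n → ℕ, (∀ x, ℓ ≤ len x) ∧
      (∀ k, ServedByLength d k (U.filter fun x => len x = k)) ∧
      ∑ x ∈ U, (len x : ℝ) ≤ U.card * (ℓ - 1 + 1 / Q) := by
  induction U using Finset.strongInduction with
  | H U ih =>
    intro ℓ hℓ
    rcases U.eq_empty_or_nonempty with rfl | hU
    · exact ⟨fun _ => ℓ, fun _ => le_rfl,
        fun k => ⟨fun _ => ∅, fun _ _ => false, by simp, by simp⟩, by simp⟩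
    obtain ⟨A, hAU, hA, hserved⟩ := h ℓ hℓ U
    have hUpos : (0 : ℝ) < U.card := by exact_mod_cast hU.card_pos
    have hApos : (0 : ℝ) < A.card := lt_of_lt_of_le (by positivity) hA
    have hAne : A.Nonempty := Finset.card_pos.mp (by exact_mod_cast hApos)
    obtain ⟨len, hlen, hk, hsum⟩ := ih (U \ A) (Finset.sdiff_ssubset hAU hAne) (ℓ + 1) (by omega)
    classical
    refine ⟨fun x => if x ∈ A then ℓ else len x, ?_, ?_, ?_⟩
    · intro x
      have := hlen x
      dsimp only
      split_ifs <;> omega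
    · intro k
      by_cases hkl : k = ℓ
      · subst hkl
        convert hserved using 1
        ext x
        have := hlen x
        simp only [Finset.mem_filter]
        constructor
        · rintro ⟨_, hx⟩
          by_contra hxA
          rw [if_neg hxA] at hx
          omega
        · intro hx
          exact ⟨hAU hx, if_pos hx⟩
      · convert hk k using 1
        ext x
        simp only [Finset.mem_filter, Finset.mem_sdiff]
        by_cases hxA : x ∈ A
        · simp [hxA, Ne.symm hkl]
        · simp [hxA]
    · have hcard : ((U \ A).card : ℝ) = U.card - A.card := by
        rw [Finset.card_sdiff_of_subset hAU, Nat.cast_sub (Finset.card_le_card hAU)]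
      rw [← Finset.sum_sdiff hAU]
      have h1 : ∑ x ∈ U \ A, ((if x ∈ A then ℓ else len x : ℕ) : ℝ) = ∑ x ∈ U \ A, (len x : ℝ) :=
        Finset.sum_congr rfl fun x hx => by rw [if_neg (Finset.mem_sdiff.mp hx).2]
      have h2 : ∑ x ∈ A, ((if x ∈ A then ℓ else len x : ℕ) : ℝ) = A.card * ℓ := by
        rw [Finset.sum_congr rfl fun x hx => by rw [if_pos hx]]
        simp
      rw [h1, h2]
      rw [hcard] at hsum
      -- Starting the rest at `ℓ + 1` costs `|U|` more than the target and saves `|A| / Q`.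
      have h3 : (U.card : ℝ) ≤ A.card * (1 / Q) := by
        rw [mul_one_div, le_div_iff₀ hQ]
        linarith
      push_cast at hsum
      nlinarith

theorem SparseSeq.nonempty {r n : ℕ} (hrn : r ≤ n) : Nonempty (SparseSeq r n) := by
  classical
  obtain ⟨s, -, hs⟩ := Finset.exists_subset_card_eq (s := (Finset.univ : Finset (Fin n)))
    (n := r) (by simpa using hrn)
  exact ⟨⟨fun j => decide (j ∈ s), by simpa using hs⟩⟩

theorem SparseSeq.card_le (r n : ℕ) : Fintype.card (SparseSeq r n) ≤ n.choose r := by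
  classical
  have h := Finset.card_le_card_of_injOn (s := (Finset.univ : Finset (SparseSeq r n)))
    (t := (Finset.univ : Finset (Fin n)).powersetCard r)
    (fun x => Finset.univ.filter fun j => x.1 j = true)
    (fun x _ => by simpa [Finset.mem_powersetCard] using x.2)
    (fun x _ y _ hxy => Subtype.ext <| funext fun j => by
      have := Finset.ext_iff.mp hxy j
      simp only [Finset.mem_filter, Finset.mem_univ, true_and] at this
      exact Bool.eq_iff_iff.mpr this)
  simpa using h

/-- Injectivity is free: equal codewords have equal lengths and bits, so they decode to the same
sequence. -/
theorem exists_code_of_served_fraction {r n d L : ℕ} (hrn : r ≤ n) {Q : ℝ} (hQ : 0 < Q)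
    (hL : 1 ≤ L)
    (h : ∀ ℓ, L ≤ ℓ → ∀ U : Finset (SparseSeq r n), ∃ A ⊆ U, Q * (U.card : ℝ) ≤ A.card ∧
      ServedByLength d ℓ A) :
    ∃ c : SparseSourceCode r n, c.IsNonadaptiveLocallyDecodable d ∧
      c.expectedLength ≤ L - 1 + 1 / Q := by
  obtain ⟨len, hlen, hk, hsum⟩ := exists_length_assignment hQ h Finset.univ L le_rfl
  choose probes decode hcard hdec using hk
  have hdec' : ∀ x : SparseSeq r n, ∃ b : Fin (len x) → Bool,
      ∀ j, decode (len x) j (fun i => b i.1) = x.1 j := fun x => hdec (len x) x (by simp)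
  choose b hb using hdec'
  -- A free `w` lets the same fact serve for decoding and, through `c x = c y`, for injectivity.
  have key : ∀ (x : SparseSeq r n) (w : List Bool), w = List.ofFn (b x) → ∀ j,
      decode w.length j (fun i => w.get i.1) = x.1 j := by
    intro x w hw j
    have aux : ∀ k (hk : len x = k) (g : Fin k → Bool), (∀ i, g i = b x (i.cast hk.symm)) →
        decode k j (fun i => g i.1) = x.1 j := by
      rintro k rfl g hg
      rw [← hb x j]
      congr 1
      funext i
      exact hg i.1
    subst hw
    refine aux _ (by simp) (List.ofFn (b x)).get fun i => ?_
    simp [Fin.cast]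
  refine ⟨⟨fun x => List.ofFn (b x), fun x hx => ?_, fun x y hxy => ?_⟩,
    ⟨fun j ℓ => probes ℓ j, fun j ℓ => decode ℓ j, fun j ℓ => hcard ℓ j, fun x j => ?_⟩, ?_⟩
  · have := congrArg List.length hx
    have := hlen x
    simp at *
    omega
  · apply Subtype.ext
    funext j
    rw [← key x _ rfl j, ← key y _ hxy j]
  · exact key x _ rfl j
  · have : Nonempty (SparseSeq r n) := SparseSeq.nonempty hrn
    have hpos : (0 : ℝ) < (Finset.univ : Finset (SparseSeq r n)).card := by
      exact_mod_cast Finset.univ_nonempty.card_pos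
    unfold SparseSourceCode.expectedLength
    rw [Finset.expect_eq_sum_div_card, div_le_iff₀ hpos]
    simp only [List.length_ofFn]
    linarith

theorem servedByLength_singleton {r n : ℕ} (d ℓ : ℕ) (x : SparseSeq r n) :
    ServedByLength d ℓ {x} :=
  ⟨fun _ => ∅, fun j _ => x.1 j, by simp, fun y hy => ⟨fun _ => false, by
    simp [Finset.mem_singleton.mp hy]⟩⟩

/-- Without probes, every sequence gets its own codeword length. -/
theorem exists_code_le_choose {r n : ℕ} (d : ℕ) (hrn : r ≤ n) :
    ∃ c : SparseSourceCode r n, c.IsNonadaptiveLocallyDecodable d ∧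
      c.expectedLength ≤ n.choose r := by
  have hpos : (0 : ℝ) < n.choose r := by exact_mod_cast Nat.choose_pos hrn
  obtain ⟨c, hc, hle⟩ := exists_code_of_served_fraction (d := d) (L := 1) hrn
    (Q := 1 / (n.choose r : ℝ)) (by positivity) le_rfl (by
      intro ℓ _ U
      rcases U.eq_empty_or_nonempty with rfl | ⟨x, hx⟩
      · exact ⟨∅, by simp, by simp, fun _ => ∅, fun _ _ => false, by simp, by simp⟩
      · refine ⟨{x}, by simpa using hx, ?_, servedByLength_singleton d ℓ x⟩
        rw [one_div_mul_eq_div, div_le_iff₀ hpos]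
        have : U.card ≤ n.choose r := (Finset.card_le_univ U).trans (SparseSeq.card_le r n)
        simpa using (by exact_mod_cast this : (U.card : ℝ) ≤ n.choose r))
  exact ⟨c, hc, by simpa using hle⟩

/-! ### Counting random position assignments -/

/-- The positions touched by the indices of `s` under the position assignment `f`. -/
def touchedPositions {n d W : ℕ} (f : Fin n → Fin d → Fin W) (s : Finset (Fin n)) :
    Finset (Fin W) :=
  s.biUnion fun j => Finset.univ.image (f j)

theorem mem_touchedPositions {n d W : ℕ} {f : Fin n → Fin d → Fin W} {s : Finset (Fin n)}
    {i : Fin W} : i ∈ touchedPositions f s ↔ ∃ j ∈ s, ∃ t, f j t = i := by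
  simp [touchedPositions]

theorem card_touchedPositions_le {n d W : ℕ} (f : Fin n → Fin d → Fin W) (s : Finset (Fin n)) :
    (touchedPositions f s).card ≤ s.card * d :=
  Finset.card_biUnion_le_card_mul _ _ _ fun j _ => by
    simpa using Finset.card_image_le (s := (Finset.univ : Finset (Fin d))) (f := f j)

/-- The position assignments that send every index of `s` into the first `L` positions. -/
def activeAssignments (n d W L : ℕ) (s : Finset (Fin n)) : Finset (Fin n → Fin d → Fin W) :=
  Finset.univ.filter fun f => ∀ j ∈ s, ∀ t, (f j t).val < L

theorem mem_activeAssignments {n d W L : ℕ} {s : Finset (Fin n)} {f : Fin n → Fin d → Fin W} :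
    f ∈ activeAssignments n d W L s ↔ ∀ j ∈ s, ∀ t, (f j t).val < L := by
  simp [activeAssignments]

/-- Each of `|s| d` independent uniform positions is below `L` with probability `L / W`;
denominators are cleared to stay in `ℕ`. -/
theorem card_activeAssignments {n d W L : ℕ} (hLW : L ≤ W) (s : Finset (Fin n)) :
    (activeAssignments n d W L s).card * W ^ (s.card * d) = L ^ (s.card * d) * W ^ (n * d) := by
  classical
  have hbox : ((Finset.univ : Finset (Fin d → Fin W)).filter
      fun g => ∀ t, (g t).val < L).card = L ^ d := by
    have : (Finset.univ : Finset (Fin d → Fin W)).filter (fun g => ∀ t, (g t).val < L) =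
        Fintype.piFinset fun _ => Finset.univ.filter fun i : Fin W => i.val < L := by
      ext g; simp
    rw [this, Fintype.card_piFinset]
    simp [Fin.card_filter_val_lt, hLW]
  have : activeAssignments n d W L s = Fintype.piFinset fun j =>
      if j ∈ s then Finset.univ.filter fun g : Fin d → Fin W => ∀ t, (g t).val < L
      else Finset.univ := by
    ext f
    simp only [mem_activeAssignments, Fintype.mem_piFinset]
    refine forall_congr' fun j => ?_
    by_cases hj : j ∈ s <;> simp [hj]
  rw [this, Fintype.card_piFinset]
  have hc : ∀ j : Fin n, (if j ∈ s then Finset.univ.filter fun g : Fin d → Fin W =>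
      ∀ t, (g t).val < L else Finset.univ).card = if j ∈ s then L ^ d else W ^ d := by
    intro j
    split_ifs
    · exact hbox
    · simp
  rw [Finset.prod_congr rfl fun j _ => hc j, Finset.prod_ite, Finset.prod_const, Finset.prod_const]
  have h1 : (Finset.univ.filter fun j => j ∈ s) = s := by simp
  have h2 : (Finset.univ.filter fun j => j ∉ s).card = n - s.card := by
    rw [← Finset.compl_filter, h1, Finset.card_compl, Fintype.card_fin]
  have h3 : s.card ≤ n := by simpa using Finset.card_le_univ s
  obtain ⟨k, hk⟩ := Nat.exists_eq_add_of_le h3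
  have h4 : n * d = s.card * d + k * d := by rw [← add_mul, ← hk]
  rw [h1, h2, h4, Nat.sub_eq_of_eq_add' hk]
  ring

/-- An index outside `s` falls inside the positions touched by `s` with frequency at most
`(|s| d / W) ^ d`. -/
theorem card_confused_le {n d W L : ℕ} (s : Finset (Fin n)) {j : Fin n} (hj : j ∉ s) :
    ((activeAssignments n d W L s).filter fun f => ∀ t, f j t ∈ touchedPositions f s).card * W ^ d
      ≤ (activeAssignments n d W L s).card * (s.card * d) ^ d := by
  classical
  have htouch : ∀ (f : Fin n → Fin d → Fin W) ω,
      touchedPositions (Function.update f j ω) s = touchedPositions f s := by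
    intro f ω
    refine Finset.biUnion_congr rfl fun k hk => ?_
    rw [Function.update_of_ne (by rintro rfl; exact hj hk)]
  let B := (activeAssignments n d W L s).filter fun f => ∀ t, f j t ∈ touchedPositions f s
  have h1 : (B ×ˢ (Finset.univ : Finset (Fin d → Fin W))).card ≤
      ((activeAssignments n d W L s).sigma fun f =>
        Fintype.piFinset fun _ : Fin d => touchedPositions f s).card := by
    -- Resampling: swapping `f j` for a fresh `ω` keeps the touched set, since `j ∉ s`, and the old
    -- `f j` is retained as a tuple of touched positions.
    refine Finset.card_le_card_of_injOn (fun p => ⟨Function.update p.1 j p.2, p.1 j⟩) ?_ ?_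
    · rintro ⟨f, ω⟩ hp
      obtain ⟨hf, hft⟩ := Finset.mem_filter.mp (Finset.mem_product.mp hp).1
      refine Finset.mem_coe.mpr (Finset.mem_sigma.mpr ⟨?_, ?_⟩)
      · rw [mem_activeAssignments] at hf ⊢
        intro k hk
        have hkj : k ≠ j := fun h => hj (h ▸ hk)
        simpa [hkj] using hf k hk
      · simpa [htouch] using hft
    · rintro ⟨f, ω⟩ _ ⟨g, ω'⟩ _ h
      simp only [Sigma.mk.injEq, heq_eq_eq] at h
      obtain ⟨h, h'⟩ := h
      have hω : ω = ω' := by simpa using congrFun h j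
      refine Prod.ext (funext fun k => ?_) hω
      by_cases hk : k = j
      · subst hk; exact h'
      · simpa [hk] using congrFun h k
  rw [Finset.card_product, Finset.card_sigma] at h1
  calc B.card * W ^ d = B.card * (Finset.univ : Finset (Fin d → Fin W)).card := by simp
    _ ≤ _ := h1
    _ ≤ ∑ _f ∈ activeAssignments n d W L s, (s.card * d) ^ d := by
        refine Finset.sum_le_sum fun f _ => ?_
        rw [Fintype.card_piFinset]
        simpa using Nat.pow_le_pow_left (card_touchedPositions_le f s) d
    _ = _ := by simp

/-- The position assignments for which `s` is active and no other index is confused with it. -/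
def separatingAssignments (n d W L : ℕ) (s : Finset (Fin n)) : Finset (Fin n → Fin d → Fin W) :=
  (activeAssignments n d W L s).filter fun f => ∀ j, j ∉ s → ∃ t, f j t ∉ touchedPositions f s

/-- Union bound: given that `s` is active, `hWd` bounds the probability of any confusion by `|s| /
(|s| + 1)`. -/
theorem card_separatingAssignments_ge {n d W L : ℕ} (hLW : L ≤ W) (hW : 0 < W)
    (s : Finset (Fin n))
    (hWd : (n * (s.card * d) ^ d * (s.card + 1) : ℝ) ≤ s.card * (W : ℝ) ^ d) :
    ((L : ℝ) / W) ^ (s.card * d) / (s.card + 1) * (W : ℝ) ^ (n * d) ≤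
      (separatingAssignments n d W L s).card := by
  classical
  set a := activeAssignments n d W L s with ha
  have hsub : a ⊆ separatingAssignments n d W L s ∪ (sᶜ).biUnion fun j =>
      a.filter fun f => ∀ t, f j t ∈ touchedPositions f s := by
    intro f hf
    by_cases h : ∀ j, j ∉ s → ∃ t, f j t ∉ touchedPositions f s
    · exact Finset.mem_union_left _ (Finset.mem_filter.mpr ⟨hf, h⟩)
    · push Not at h
      obtain ⟨j, hj, hjt⟩ := h
      exact Finset.mem_union_right _ (Finset.mem_biUnion.mpr
        ⟨j, Finset.mem_compl.mpr hj, Finset.mem_filter.mpr ⟨hf, hjt⟩⟩)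
  have hcard : a.card * W ^ d ≤ (separatingAssignments n d W L s).card * W ^ d +
      n * (a.card * (s.card * d) ^ d) := by
    calc a.card * W ^ d ≤ ((separatingAssignments n d W L s).card + ∑ j ∈ sᶜ,
          (a.filter fun f => ∀ t, f j t ∈ touchedPositions f s).card) * W ^ d :=
          Nat.mul_le_mul_right _ ((Finset.card_le_card hsub).trans
            ((Finset.card_union_le _ _).trans
              (Nat.add_le_add_left Finset.card_biUnion_le _)))
      _ = (separatingAssignments n d W L s).card * W ^ d + ∑ j ∈ sᶜ,
          (a.filter fun f => ∀ t, f j t ∈ touchedPositions f s).card * W ^ d := by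
          rw [add_mul, Finset.sum_mul]
      _ ≤ (separatingAssignments n d W L s).card * W ^ d +
          ∑ _j ∈ sᶜ, a.card * (s.card * d) ^ d :=
          Nat.add_le_add_left (Finset.sum_le_sum fun j hj =>
            card_confused_le s (Finset.mem_compl.mp hj)) _
      _ ≤ _ := by
          rw [Finset.sum_const, smul_eq_mul]
          exact Nat.add_le_add_left (Nat.mul_le_mul_right _
            (by simpa using Finset.card_le_univ sᶜ)) _
  have hact : (a.card : ℝ) * (W : ℝ) ^ (s.card * d) =
      (L : ℝ) ^ (s.card * d) * (W : ℝ) ^ (n * d) := by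
    exact_mod_cast card_activeAssignments hLW s
  have hcard' : (a.card : ℝ) * (W : ℝ) ^ d ≤ (separatingAssignments n d W L s).card * (W : ℝ) ^ d +
      n * (a.card * (s.card * d) ^ d) := by exact_mod_cast hcard
  have hWpos : (0 : ℝ) < W := by exact_mod_cast hW
  have hsep : (a.card : ℝ) ≤ (separatingAssignments n d W L s).card * (s.card + 1) := by
    have hp : (0 : ℝ) < (W : ℝ) ^ d := by positivity
    have h2 := mul_le_mul_of_nonneg_left hWd (Nat.cast_nonneg (α := ℝ) a.card)
    have h3 := mul_le_mul_of_nonneg_right hcard' (by positivity : (0 : ℝ) ≤ s.card + 1)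
    refine le_of_mul_le_mul_right ?_ hp
    linarith
  rw [div_pow, div_div, div_mul_eq_mul_div, ← hact, div_le_iff₀ (by positivity)]
  calc (a.card : ℝ) * (W : ℝ) ^ (s.card * d)
      ≤ (separatingAssignments n d W L s).card * (s.card + 1) * (W : ℝ) ^ (s.card * d) := by gcongr
    _ = _ := by ring

/-! ### Decoding by conjunction, and averaging over assignments -/

/-- The support of a sparse sequence. -/
def SparseSeq.support {r n : ℕ} (x : SparseSeq r n) : Finset (Fin n) :=
  Finset.univ.filter fun j => x.1 j = true

/-- A position assignment `f` serves all the sequences whose support it separates: the codeword is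
the indicator of the touched positions, and an index is decoded by the conjunction of its probes. -/
theorem servedByLength_of_separating {r n d W L ℓ : ℕ} (hL : L ≤ ℓ) (f : Fin n → Fin d → Fin W)
    (A : Finset (SparseSeq r n)) (hA : ∀ x ∈ A, f ∈ separatingAssignments n d W L x.support) :
    ServedByLength d ℓ A := by
  classical
  refine ⟨fun j => Finset.univ.filter fun i => ∃ t, (f j t).val = i.val,
    -- Positions beyond the string are not probed; the test against `L` makes indices that have such
    -- positions decode to zero.
    fun j g => decide ((∀ t, (f j t).val < L) ∧ ∀ i, g i = true), fun j => ?_, fun x hx => ?_⟩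
  · calc (Finset.univ.filter fun i : Fin ℓ => ∃ t, (f j t).val = i.val).card
        ≤ (Finset.univ.image fun t => (f j t).val).card :=
          Finset.card_le_card_of_injOn Fin.val (fun i hi => by simpa using hi)
            (fun _ _ _ _ h => Fin.ext h)
      _ ≤ (Finset.univ : Finset (Fin d)).card := Finset.card_image_le
      _ = d := by simp
  · obtain ⟨hact, hsep⟩ := Finset.mem_filter.mp (hA x hx)
    rw [mem_activeAssignments] at hact
    refine ⟨fun i => decide (∃ p, p ∈ touchedPositions f x.support ∧ p.val = i.val), fun j => ?_⟩
    by_cases hj : j ∈ x.support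
    · have hxj : x.1 j = true := (Finset.mem_filter.mp hj).2
      rw [hxj, decide_eq_true_eq]
      refine ⟨hact j hj, fun i => ?_⟩
      obtain ⟨t, ht⟩ := (Finset.mem_filter.mp i.2).2
      exact decide_eq_true ⟨f j t, mem_touchedPositions.mpr ⟨j, hj, t, rfl⟩, ht⟩
    · have hxj : x.1 j = false := by
        by_contra h
        exact hj (Finset.mem_filter.mpr ⟨Finset.mem_univ _, by simpa using h⟩)
      rw [hxj, decide_eq_false_iff_not]
      rintro ⟨hlt, hall⟩
      obtain ⟨t, ht⟩ := hsep j hj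
      have := hall ⟨⟨(f j t).val, (hlt t).trans_le hL⟩, by simp⟩
      obtain ⟨p, hp, hpt⟩ := of_decide_eq_true this
      exact ht (Fin.ext hpt ▸ hp)

/-- Double counting of pairs of an assignment and a sequence it separates: some `f` does at least as
well as the average. -/
theorem exists_served_fraction {r n d W L ℓ : ℕ} (hL : L ≤ ℓ) (hLW : L ≤ W) (hW : 0 < W)
    (hWd : (n * (r * d) ^ d * (r + 1) : ℝ) ≤ r * (W : ℝ) ^ d) (U : Finset (SparseSeq r n)) :
    ∃ A ⊆ U, ((L : ℝ) / W) ^ (r * d) / (r + 1) * (U.card : ℝ) ≤ A.card ∧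
      ServedByLength d ℓ A := by
  classical
  set Q : ℝ := ((L : ℝ) / W) ^ (r * d) / (r + 1) with hQ
  have : Nonempty (Fin W) := ⟨⟨0, hW⟩⟩
  let good : (Fin n → Fin d → Fin W) → Finset (SparseSeq r n) := fun f =>
    U.filter fun x => f ∈ separatingAssignments n d W L x.support
  have hsum : ∑ _f : Fin n → Fin d → Fin W, Q * (U.card : ℝ) ≤
      ∑ f, ((good f).card : ℝ) := by
    have hswap : ∑ f, (good f).card =
        ∑ x ∈ U, (separatingAssignments n d W L x.support).card := by
      simp only [good, Finset.card_filter]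
      rw [Finset.sum_comm]
      refine Finset.sum_congr rfl fun x _ => ?_
      rw [← Finset.card_filter]
      simp
    rw [← Nat.cast_sum, hswap, Nat.cast_sum]
    calc ∑ _f : Fin n → Fin d → Fin W, Q * (U.card : ℝ)
        = ∑ _x ∈ U, Q * (W : ℝ) ^ (n * d) := by
          simp only [Finset.sum_const, Finset.card_univ, Fintype.card_fun, Fintype.card_fin,
            nsmul_eq_mul]
          push_cast
          ring
      _ ≤ _ := by
          refine Finset.sum_le_sum fun x _ => ?_
          have hx : x.support.card = r := x.2
          have := card_separatingAssignments_ge (L := L) hLW hW x.support (by rw [hx]; exact hWd)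
          rwa [hx] at this
  obtain ⟨f, -, hf⟩ := Finset.exists_le_of_sum_le Finset.univ_nonempty hsum
  exact ⟨good f, Finset.filter_subset _ _, hf,
    servedByLength_of_separating hL f _ fun x hx => (Finset.mem_filter.mp hx).2⟩

/-! ### Choice of parameters -/

theorem Nat.pow_le_pow_mul_choose {r n : ℕ} (hrn : r ≤ n) : n ^ r ≤ r ^ r * n.choose r := by
  induction r generalizing n with
  | zero => simp
  | succ r ih =>
    obtain ⟨n, rfl⟩ := Nat.exists_eq_succ_of_ne_zero (by omega : n ≠ 0)
    have hrn' : r ≤ n := by omega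
    have hpos : 0 < r ^ r := Nat.pow_self_pos
    have key : (n + 1) ^ r ≤ (r + 1) ^ r * n.choose r := by
      refine Nat.le_of_mul_le_mul_left ?_ hpos
      calc r ^ r * (n + 1) ^ r = (r * (n + 1)) ^ r := (mul_pow _ _ _).symm
        _ ≤ ((r + 1) * n) ^ r := Nat.pow_le_pow_left (by nlinarith) r
        _ = (r + 1) ^ r * n ^ r := mul_pow _ _ _
        _ ≤ (r + 1) ^ r * (r ^ r * n.choose r) := Nat.mul_le_mul_left _ (ih hrn')
        _ = _ := by ring
    calc (n + 1) ^ (r + 1) = (n + 1) ^ r * (n + 1) := pow_succ _ _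
      _ ≤ (r + 1) ^ r * n.choose r * (n + 1) := Nat.mul_le_mul_right _ key
      _ = (r + 1) ^ r * ((n + 1) * n.choose r) := by ring
      _ = (r + 1) ^ r * ((n + 1).choose (r + 1) * (r + 1)) := by rw [Nat.add_one_mul_choose_eq]
      _ = _ := by ring

theorem add_one_pow_le_three_mul_pow {m : ℕ} {s : ℝ} (hm : 0 < m) (hs : 1 ≤ s) :
    (m * s + 1) ^ m ≤ 3 * (m * s) ^ m := by
  have hm' : (0 : ℝ) < m := by exact_mod_cast hm
  calc (m * s + 1) ^ m ≤ ((1 + (m : ℝ)⁻¹) * (m * s)) ^ m := by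
        refine pow_le_pow_left₀ (by positivity) ?_ m
        rw [add_mul, inv_mul_cancel_left₀ hm'.ne']
        linarith
    _ = (1 + (m : ℝ)⁻¹) ^ m * (m * s) ^ m := mul_pow _ _ _
    _ ≤ 3 * (m * s) ^ m := by
        refine mul_le_mul_of_nonneg_right ?_ (by positivity)
        exact Real.one_add_inv_pow_le_exp.trans (Real.exp_one_lt_d9.le.trans (by norm_num))

/-- A width `W` that is large enough for separation but not larger than needed. -/
theorem exists_separating_width {r d n : ℕ} (hr : 0 < r) (hd : 0 < d) (hrn : r ≤ n) :
    ∃ W : ℕ, 0 < W ∧ (n * (r * d) ^ d * (r + 1) : ℝ) ≤ r * (W : ℝ) ^ d ∧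
      (r + 1) * (W : ℝ) ^ (r * d) ≤
        3 * ((r * d : ℕ) : ℝ) ^ (r * d) * (((r : ℝ) + 1) ^ (r + 1) * n.choose r) := by
  have hr' : (0 : ℝ) < r := by exact_mod_cast hr
  have hd' : (0 : ℝ) < d := by exact_mod_cast hd
  have hrn' : (r : ℝ) ≤ n := by exact_mod_cast hrn
  -- With this `N`, the real width `r d N^(1/d)` gives equality in the separation condition;
  -- rounding it up costs the factor 3.
  set N : ℝ := n * (r + 1) / r with hN
  have hN1 : 1 ≤ N := by
    rw [hN, le_div_iff₀ hr']
    nlinarith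
  set s : ℝ := N ^ (1 / (d : ℝ)) with hs
  have hsd : s ^ d = N := by
    rw [hs, one_div, Real.rpow_inv_natCast_pow (by linarith) hd.ne']
  have hs1 : 1 ≤ s := Real.one_le_rpow hN1 (by positivity)
  set m : ℕ := r * d with hm
  have hm0 : 0 < m := Nat.mul_pos hr hd
  have hm' : (0 : ℝ) < m := by exact_mod_cast hm0
  have hmcast : (m : ℝ) = r * d := by rw [hm, Nat.cast_mul]
  have hms : 0 < m * s := by positivity
  refine ⟨⌈m * s⌉₊, Nat.ceil_pos.mpr hms, ?_, ?_⟩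
  · calc (n * (r * d) ^ d * (r + 1) : ℝ) = r * (m * s) ^ d := by
          rw [← hmcast, mul_pow, hsd, hN]
          field_simp
      _ ≤ _ := by
          gcongr
          exact Nat.le_ceil _
  · have hpow : (r + 1) * N ^ r ≤ ((r : ℝ) + 1) ^ (r + 1) * n.choose r := by
      have : (n : ℝ) ^ r ≤ r ^ r * n.choose r := by
        exact_mod_cast Nat.pow_le_pow_mul_choose hrn
      rw [hN, div_pow, mul_pow, ← mul_div_assoc, div_le_iff₀ (by positivity)]
      calc ((r : ℝ) + 1) * (n ^ r * (r + 1) ^ r) = (r + 1) ^ (r + 1) * n ^ r := by ring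
        _ ≤ (r + 1) ^ (r + 1) * (r ^ r * n.choose r) := by gcongr
        _ = _ := by ring
    calc (r + 1) * ((⌈m * s⌉₊ : ℕ) : ℝ) ^ m ≤ (r + 1) * (m * s + 1) ^ m := by
          gcongr
          exact (Nat.ceil_lt_add_one hms.le).le
      _ ≤ (r + 1) * (3 * (m * s) ^ m) := by
          gcongr
          exact add_one_pow_le_three_mul_pow hm0 hs1
      _ = 3 * (m : ℝ) ^ m * ((r + 1) * N ^ r) := by
          have : s ^ m = N ^ r := by rw [hm, mul_comm r d, pow_mul, hsd]
          rw [mul_pow, this]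
          ring
      _ ≤ _ := by gcongr

theorem theorem2 (r d n : ℕ) (hrn : r ≤ n) :
    ∃ c : SparseSourceCode r n, c.IsNonadaptiveLocallyDecodable d ∧
      c.expectedLength ≤
        30 * ((r : ℝ) * d + 1) *
          (((r : ℝ) + 1) ^ (r + 1) * (n.choose r : ℝ)) ^ (1 / ((r : ℝ) * d + 1)) := by
  set B : ℝ := ((r : ℝ) + 1) ^ (r + 1) * (n.choose r : ℝ) with hB
  have hC1 : (1 : ℝ) ≤ n.choose r := by exact_mod_cast Nat.choose_pos hrn
  have hr1 : (1 : ℝ) ≤ (r : ℝ) + 1 := by linarith [Nat.cast_nonneg (α := ℝ) r]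
  have hBC : (n.choose r : ℝ) ≤ B := le_mul_of_one_le_left (by linarith) (one_le_pow₀ hr1)
  have hB1 : 1 ≤ B := hC1.trans hBC
  rcases Nat.eq_zero_or_pos (r * d) with h0 | hpos
  · have h0' : (r : ℝ) * d = 0 := by exact_mod_cast h0
    obtain ⟨c, hc, hle⟩ := exists_code_le_choose d hrn
    refine ⟨c, hc, hle.trans ?_⟩
    rw [h0']
    norm_num
    linarith
  · have hr : 0 < r := Nat.pos_of_mul_pos_right hpos
    have hd : 0 < d := Nat.pos_of_mul_pos_left hpos
    obtain ⟨W, hW, hWd, hWm⟩ := exists_separating_width hr hd hrn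
    set m : ℕ := r * d with hm
    have hmcast : (r : ℝ) * d = m := by rw [hm, Nat.cast_mul]
    rw [hmcast]
    -- At `L ≈ m T` the bound on `W` gives `1/Q ≤ 3 B / T^m = 3 T`, in balance with `L`.
    set T : ℝ := B ^ (1 / ((m : ℝ) + 1)) with hT
    have hT1 : 1 ≤ T := Real.one_le_rpow hB1 (by positivity)
    have hTB : T ^ (m + 1) = B := by
      have := Real.rpow_inv_natCast_pow (by linarith : 0 ≤ B) (Nat.succ_ne_zero m)
      rwa [Nat.succ_eq_add_one, Nat.cast_add_one, ← one_div] at this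
    have hm1 : (1 : ℝ) ≤ m := by exact_mod_cast hpos
    have hrm : (r : ℝ) ≤ m := by exact_mod_cast Nat.le_mul_of_pos_right r hd
    have hmT : 0 < m * T := by positivity
    have hW' : (0 : ℝ) < W := by exact_mod_cast hW
    have hcode : ∀ L : ℕ, 1 ≤ L → L ≤ W → ∃ c : SparseSourceCode r n,
        c.IsNonadaptiveLocallyDecodable d ∧
        c.expectedLength ≤ L - 1 + 1 / (((L : ℝ) / W) ^ m / (r + 1)) := by
      intro L hL hLW
      have hL' : (0 : ℝ) < L := by exact_mod_cast hL
      exact exists_code_of_served_fraction hrn (by positivity) hL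
        fun ℓ hℓ U => exists_served_fraction hℓ hLW hW hWd U
    have hmT' : (m : ℝ) ≤ m * T := le_mul_of_one_le_right (by positivity) hT1
    have hceil := Nat.ceil_lt_add_one hmT.le
    rcases le_total ⌈m * T⌉₊ W with hle | hle
    · obtain ⟨c, hc, hlen⟩ := hcode _ (Nat.ceil_pos.mpr hmT) hle
      refine ⟨c, hc, hlen.trans ?_⟩
      have hLpos : (0 : ℝ) < (⌈m * T⌉₊ : ℕ) := by exact_mod_cast Nat.ceil_pos.mpr hmT
      have hQ : 1 / ((((⌈m * T⌉₊ : ℕ) : ℝ) / W) ^ m / (r + 1)) ≤ 3 * T := by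
        rw [one_div_div, div_pow, div_div_eq_mul_div, div_le_iff₀ (by positivity)]
        calc (r + 1) * (W : ℝ) ^ m ≤ 3 * (m : ℝ) ^ m * B := hWm
          _ = 3 * T * (m * T) ^ m := by
            rw [← hTB]
            ring
          _ ≤ _ := by
            gcongr
            exact Nat.le_ceil _
      nlinarith
    · obtain ⟨c, hc, hlen⟩ := hcode W hW le_rfl
      refine ⟨c, hc, hlen.trans ?_⟩
      have hWle : (W : ℝ) ≤ (⌈m * T⌉₊ : ℕ) := by exact_mod_cast hle
      rw [div_self hW'.ne', one_pow, one_div_one_div]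
      nlinarith
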